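/- Let $n, k, t$ be nonnegative integers with $n \geq (k-t+1)(t+1)$, and let $\mathcal{F}$ be a family of subsets of $[n]=\{1,\dots,n\}$, each of size at most $k$. Suppose that for all $A, B \in \mathcal{F}$ (the case $A = B$ included) with $|A \cap B| < t$ we have $|A \triangle B| \leq k-t$, where $A \triangle B$ denotes the symmetric difference. Then $$|\mathcal{F}| \leq \sum_{i=0}^{k-t} \binom{n-t}{k-t-i} = \binom{n-t}{k-t} + \binom{n-t}{k-t-1} + \cdots + \binom{n-t}{0},$$ where the sum is empty, hence equal to $0$, if $k < t$. -/

import Mathlib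

/-! Adjoining a point x to members of size below k, wherever this gives a new set, preserves the
hypothesis. In a family closed under such steps, a pair with |A ∩ B| < t could be enlarged to one at
distance k-t+1 with the same intersection, so the family is t-intersecting. Each layer of j-sets
then obeys the uniform Erdős–Ko–Rado bound C(n-t, j-t), and the layers add up to the claim.

The uniform bound is proved in weighted form: a trace on the first l points weighs as much as the
number of k-sets over it. `IsTIntersecting.exists_pull` drops the last point without losing weight,
until l = t and only the full set is left. After stabilising, two traces can fail to t-intersect
only if they cover all l points and their sizes add up to N = l+t-1. So levels i and N-i compete and
one of them is discarded; in the middle level the sets avoiding a well-chosen point are kept, and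
there n ≥ (k-t+1)(t+1) is needed in full. -/

/-- Every two (not necessarily distinct) members meet in at least `t` elements. -/
def IsTIntersecting {α : Type*} [DecidableEq α] (t : ℕ) (G : Finset (Finset α)) : Prop :=
  ∀ A ∈ G, ∀ B ∈ G, t ≤ (A ∩ B).card

/-! ### Shifts that preserve t-intersection -/

section Shift

variable {α : Type*} [DecidableEq α]

open Classical in
/-- The shift `a → x` of the set `A` relative to the family `G`. -/
noncomputable def shiftSet (G : Finset (Finset α)) (a x : α) (A : Finset α) : Finset α :=
  if a ∈ A ∧ x ∉ A ∧ insert x (A.erase a) ∉ G then insert x (A.erase a) else A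

theorem insert_erase_injective {a x : α} {A B : Finset α} (haA : a ∈ A) (haB : a ∈ B)
    (hxA : x ∉ A) (hxB : x ∉ B) (h : insert x (A.erase a) = insert x (B.erase a)) : A = B := by
  ext y
  have := Finset.ext_iff.1 h y
  grind

theorem shiftSet_injOn (G : Finset (Finset α)) (a x : α) :
    Set.InjOn (shiftSet G a x) (G : Set (Finset α)) := by
  intro A hA B hB h
  simp only [Finset.mem_coe] at hA hB
  unfold shiftSet at h
  split_ifs at h with h1 h2 h2
  · exact insert_erase_injective h1.1 h2.1 h1.2.1 h2.2.1 h
  · exact absurd (h ▸ hB) h1.2.2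
  · exact absurd (h ▸ hA) h2.2.2
  · exact h

theorem card_insert_erase {a x : α} {A : Finset α} (ha : a ∈ A) (hx : x ∉ A) :
    (insert x (A.erase a)).card = A.card := by
  rw [Finset.card_insert_of_notMem (fun h => hx (Finset.mem_of_mem_erase h)),
    Finset.card_erase_add_one ha]

theorem card_shiftSet (G : Finset (Finset α)) (a x : α) (A : Finset α) :
    (shiftSet G a x A).card = A.card := by
  unfold shiftSet
  split_ifs with h
  · exact card_insert_erase h.1 h.2.1
  · rfl

/-- If B stays because its shift B' is already in G, then the shifted A meets B in as many points as
A meets B'. Otherwise the intersection either is unchanged or loses at most a and gains x. -/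
theorem le_card_inter_of_shift {G : Finset (Finset α)} {t : ℕ} (hG : IsTIntersecting t G)
    {a x : α} {A B : Finset α} (hA : A ∈ G) (hB : B ∈ G) (ha : a ∈ A) (hx : x ∉ A)
    (hn : ¬(a ∈ B ∧ x ∉ B ∧ insert x (B.erase a) ∉ G)) :
    t ≤ (insert x (A.erase a) ∩ B).card := by
  have hAB := hG A hA B hB
  have hne : x ≠ a := fun h => hx (h ▸ ha)
  by_cases hxB : x ∈ B
  · refine hAB.trans ?_
    have : insert x (A.erase a) ∩ B = insert x ((A ∩ B).erase a) := by
      ext y; grind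
    rw [this, Finset.card_insert_of_notMem (by grind)]
    have := Finset.pred_card_le_card_erase (s := A ∩ B) (a := a)
    omega
  · by_cases haB : a ∈ B
    · have hB' : insert x (B.erase a) ∈ G := by
        by_contra h
        exact hn ⟨haB, hxB, h⟩
      refine (hG A hA _ hB').trans (le_of_eq ?_)
      congr 1
      ext y; grind
    · refine hAB.trans (le_of_eq ?_)
      congr 1
      ext y; grind

theorem IsTIntersecting.image_shiftSet {G : Finset (Finset α)} {t : ℕ} (hG : IsTIntersecting t G)
    (a x : α) : IsTIntersecting t (G.image (shiftSet G a x)) := by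
  intro A' hA' B' hB'
  obtain ⟨A, hA, rfl⟩ := Finset.mem_image.1 hA'
  obtain ⟨B, hB, rfl⟩ := Finset.mem_image.1 hB'
  unfold shiftSet
  split_ifs with h1 h2 h2
  · refine (hG A hA B hB).trans (le_of_eq ?_)
    have : insert x (A.erase a) ∩ insert x (B.erase a) = insert x ((A ∩ B).erase a) := by
      ext y; grind
    rw [this, card_insert_erase (by grind) (by grind)]
  · exact le_card_inter_of_shift hG hA hB h1.1 h1.2.1 h2
  · rw [Finset.inter_comm]
    exact le_card_inter_of_shift hG hB hA h2.1 h2.2.1 h1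
  · exact hG A hA B hB

/-- A `t`-intersecting family of subsets of `s` can be replaced, without losing weight, by one that
is closed under adjoining `a` and under replacing `a` by another element of `s`. -/
theorem IsTIntersecting.exists_stable {s : Finset α} {a : α} (ha : a ∈ s) {t : ℕ}
    {G : Finset (Finset α)} (hG : IsTIntersecting t G) (hGs : G ⊆ s.powerset) (u : ℕ → ℕ) :
    ∃ G' ⊆ s.powerset, IsTIntersecting t G' ∧
      ∑ E ∈ G, u E.card ≤ ∑ E ∈ G', u E.card ∧
      (∀ E ∈ G', insert a E ∈ G') ∧
      ∀ E ∈ G', a ∈ E → ∀ x ∈ s, x ∉ E → insert x (E.erase a) ∈ G' := by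
  classical
  let P : Finset (Finset (Finset α)) := s.powerset.powerset.filter fun G' =>
    IsTIntersecting t G' ∧ ∑ E ∈ G, u E.card ≤ ∑ E ∈ G', u E.card
  have hP : P.Nonempty := ⟨G, by simp [P, hG, Finset.mem_powerset.2 hGs]⟩
  -- The potential is positive on every set and larger on sets avoiding a, so both a new set and an
  -- effective shift away from a would increase it.
  obtain ⟨M, hM, hmax⟩ := P.exists_max_image
    (fun G' => ∑ E ∈ G', (if a ∈ E then 1 else 2)) hP
  simp only [P, Finset.mem_filter, Finset.mem_powerset] at hM hmax
  obtain ⟨hMs, hMt, hMu⟩ := hM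
  refine ⟨M, hMs, hMt, hMu, ?_, ?_⟩
  · intro E hE
    by_contra hn
    have key := hmax (insert (insert a E) M) ⟨?_, ?_, ?_⟩
    · rw [Finset.sum_insert hn] at key
      simp at key
    · refine Finset.insert_subset ?_ hMs
      exact Finset.mem_powerset.2 (Finset.insert_subset ha (Finset.mem_powerset.1 (hMs hE)))
    · have h1 : ∀ B ∈ M, t ≤ (insert a E ∩ B).card := fun B hB =>
        (hMt E hE B hB).trans (Finset.card_le_card
          (Finset.inter_subset_inter_right (Finset.subset_insert a E)))
      intro A hA B hB
      rcases Finset.mem_insert.1 hA with rfl | hA <;> rcases Finset.mem_insert.1 hB with rfl | hB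
      · exact (hMt E hE E hE).trans (Finset.card_le_card
          (Finset.inter_subset_inter (Finset.subset_insert a E) (Finset.subset_insert a E)))
      · exact h1 B hB
      · rw [Finset.inter_comm]; exact h1 A hA
      · exact hMt A hA B hB
    · rw [Finset.sum_insert hn]; omega
  · intro E hE haE x hx hxE
    by_contra hn
    have key := hmax (M.image (shiftSet M a x)) ⟨?_, hMt.image_shiftSet a x, ?_⟩
    · rw [Finset.sum_image (shiftSet_injOn M a x)] at key
      refine absurd key (not_le.2 (Finset.sum_lt_sum ?_ ⟨E, hE, ?_⟩))
      · intro B hB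
        unfold shiftSet
        grind
      · unfold shiftSet
        grind
    · intro B' hB'
      obtain ⟨B, hB, rfl⟩ := Finset.mem_image.1 hB'
      have := Finset.mem_powerset.1 (hMs hB)
      rw [Finset.mem_powerset]
      unfold shiftSet
      split_ifs
      · exact Finset.insert_subset hx ((Finset.erase_subset _ _).trans this)
      · exact this
    · rw [Finset.sum_image (shiftSet_injOn M a x)]
      simpa [card_shiftSet] using hMu

end Shift
-- Up-shifts and reduction to t-intersecting families
section UpShift

variable {α : Type*} [DecidableEq α]

/-- Members meeting in fewer than `t` elements differ in at most `d` elements. -/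
def IsCloseOrTIntersecting (t d : ℕ) (F : Finset (Finset α)) : Prop :=
  ∀ A ∈ F, ∀ B ∈ F, (A ∩ B).card < t → (symmDiff A B).card ≤ d

/-- Adjoining `x` to the set `A` of size less than `k`, relative to the family `F`. -/
def upShiftSet (F : Finset (Finset α)) (k : ℕ) (x : α) (A : Finset α) : Finset α :=
  if x ∉ A ∧ A.card < k ∧ insert x A ∉ F then insert x A else A

theorem upShiftSet_injOn (F : Finset (Finset α)) (k : ℕ) (x : α) :
    Set.InjOn (upShiftSet F k x) (F : Set (Finset α)) := by
  intro A hA B hB h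
  simp only [Finset.mem_coe] at hA hB
  unfold upShiftSet at h
  split_ifs at h with h1 h2 h2
  · rw [← Finset.erase_insert h1.1, h, Finset.erase_insert h2.1]
  · exact absurd (h ▸ hB) h1.2.2
  · exact absurd (h ▸ hA) h2.2.2
  · exact h

theorem card_upShiftSet_le {F : Finset (Finset α)} {k : ℕ} {x : α} {A : Finset α}
    (hA : A.card ≤ k) : (upShiftSet F k x A).card ≤ k := by
  unfold upShiftSet
  split_ifs with h
  · rw [Finset.card_insert_of_notMem h.1]; exact h.2.1
  · exact hA

/-- If B stays because `insert x B` is in F, the point x is traded between the two sets. If it stays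
because |B| = k, then |A ∩ B| < t would force |B \ A| > d, against closeness. -/
theorem card_symmDiff_insert_le {F : Finset (Finset α)} {k t d : ℕ} (hk : d + t = k)
    (hF : ∀ A ∈ F, A.card ≤ k) (h : IsCloseOrTIntersecting t d F) {x : α} {A B : Finset α}
    (hA : A ∈ F) (hB : B ∈ F) (hx : x ∉ A)
    (hn : ¬(x ∉ B ∧ B.card < k ∧ insert x B ∉ F)) (hlt : (insert x A ∩ B).card < t) :
    (symmDiff (insert x A) B).card ≤ d := by
  have hlt' : (A ∩ B).card < t := (Finset.card_le_card
    (Finset.inter_subset_inter_right (Finset.subset_insert x A))).trans_lt hlt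
  by_cases hxB : x ∈ B
  · refine (Finset.card_le_card ?_).trans (h A hA B hB hlt')
    intro y hy
    rw [Finset.mem_symmDiff] at hy ⊢
    grind
  · by_cases hBk : B.card < k
    · have hB' : insert x B ∈ F := by
        by_contra hc
        exact hn ⟨hxB, hBk, hc⟩
      have e1 : symmDiff (insert x A) B = symmDiff A (insert x B) := by
        ext y; simp only [Finset.mem_symmDiff]; grind
      have e2 : A ∩ insert x B = A ∩ B := by
        ext y; grind
      rw [e1]
      exact h A hA _ hB' (by rwa [e2])
    · have hc := h A hA B hB hlt'
      have h1 : (B \ A).card ≤ (symmDiff A B).card := by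
        apply Finset.card_le_card
        intro y hy
        rw [Finset.mem_symmDiff]; grind
      have h2 := Finset.card_sdiff_add_card_inter B A
      rw [Finset.inter_comm] at h2
      have := hF B hB
      omega

theorem IsCloseOrTIntersecting.image_upShiftSet {F : Finset (Finset α)} {k t d : ℕ}
    (hk : d + t = k) (hF : ∀ A ∈ F, A.card ≤ k) (h : IsCloseOrTIntersecting t d F) (x : α) :
    IsCloseOrTIntersecting t d (F.image (upShiftSet F k x)) := by
  intro A' hA' B' hB'
  obtain ⟨A, hA, rfl⟩ := Finset.mem_image.1 hA'
  obtain ⟨B, hB, rfl⟩ := Finset.mem_image.1 hB'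
  unfold upShiftSet
  split_ifs with h1 h2 h2
  · intro hlt
    have e : symmDiff (insert x A) (insert x B) = symmDiff A B := by
      ext y; simp only [Finset.mem_symmDiff]; grind
    rw [e]
    exact h A hA B hB ((Finset.card_le_card (Finset.inter_subset_inter
      (Finset.subset_insert x A) (Finset.subset_insert x B))).trans_lt hlt)
  · exact card_symmDiff_insert_le hk hF h hA hB h1.1 h2
  · rw [Finset.inter_comm, symmDiff_comm]
    exact card_symmDiff_insert_le hk hF h hB hA h2.1 h1
  · exact h A hA B hB

theorem IsCloseOrTIntersecting.isTIntersecting [Fintype α] {F : Finset (Finset α)} {k t d : ℕ}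
    (hk : d + t = k) (hn : k ≤ Fintype.card α) (h : IsCloseOrTIntersecting t d F)
    (hup : ∀ A ∈ F, ∀ C, A ⊆ C → C.card ≤ k → C ∈ F) : IsTIntersecting t F := by
  intro A hA B hB
  by_contra! hlt
  have hd := h A hA B hB hlt
  have hsum : (A ∩ B).card + (symmDiff A B).card = (A ∪ B).card := by
    rw [← Finset.card_union_of_disjoint]
    · congr 1
      ext y; simp only [Finset.mem_union, Finset.mem_inter, Finset.mem_symmDiff]; tauto
    · rw [Finset.disjoint_left]
      intro y; simp only [Finset.mem_inter, Finset.mem_symmDiff]; tauto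
  have hcompl := Finset.card_add_card_compl (A ∪ B)
  -- Adding X to A raises the distance to exactly d + 1, while |A ∪ X| ≤ |A ∩ B| + d + 1 ≤ k.
  obtain ⟨X, hX, hXc⟩ := Finset.exists_subset_card_eq
    (s := (A ∪ B)ᶜ) (n := d + 1 - (symmDiff A B).card) (by omega)
  have hX' : ∀ y ∈ X, y ∉ A ∧ y ∉ B := by
    intro y hy
    have := hX hy
    simpa using this
  have hAle : A.card ≤ (A ∪ B).card := Finset.card_le_card Finset.subset_union_left
  have hmem : A ∪ X ∈ F := by
    refine hup A hA _ Finset.subset_union_left ?_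
    have := Finset.card_union_le A X
    omega
  have e1 : (A ∪ X) ∩ B = A ∩ B := by
    ext y; have := hX' y; simp only [Finset.mem_union, Finset.mem_inter]; tauto
  have e2 : symmDiff (A ∪ X) B = symmDiff A B ∪ X := by
    ext y; have := hX' y; simp only [Finset.mem_union, Finset.mem_symmDiff]; tauto
  have hdisj : Disjoint (symmDiff A B) X := by
    rw [Finset.disjoint_left]
    intro y; have := hX' y; simp only [Finset.mem_symmDiff]; tauto
  have := h _ hmem B hB (by rwa [e1])
  rw [e2, Finset.card_union_of_disjoint hdisj] at this
  omega

/-- Repeated up-shifting turns the hypothesis into the `t`-intersection property. -/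
theorem IsCloseOrTIntersecting.exists_isTIntersecting [Fintype α] {F : Finset (Finset α)}
    {k t d : ℕ} (hk : d + t = k) (hn : k ≤ Fintype.card α) (hF : ∀ A ∈ F, A.card ≤ k)
    (h : IsCloseOrTIntersecting t d F) :
    ∃ G : Finset (Finset α), G.card = F.card ∧ (∀ A ∈ G, A.card ≤ k) ∧ IsTIntersecting t G := by
  classical
  let P : Finset (Finset (Finset α)) := Finset.univ.filter fun G =>
    G.card = F.card ∧ (∀ A ∈ G, A.card ≤ k) ∧ IsCloseOrTIntersecting t d G
  have hP : P.Nonempty := ⟨F, Finset.mem_filter.2 ⟨Finset.mem_univ _, rfl, hF, h⟩⟩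
  obtain ⟨M, hM, hmax⟩ := P.exists_max_image (fun G => ∑ E ∈ G, E.card) hP
  simp only [P, Finset.mem_filter, Finset.mem_univ, true_and] at hM hmax
  obtain ⟨hMc, hMk, hMd⟩ := hM
  refine ⟨M, hMc, hMk, hMd.isTIntersecting hk hn ?_⟩
  have step : ∀ A ∈ M, ∀ x ∉ A, A.card < k → insert x A ∈ M := by
    intro A hA x hx hAk
    by_contra hn
    have key := hmax (M.image (upShiftSet M k x))
      ⟨(Finset.card_image_of_injOn (upShiftSet_injOn M k x)).trans hMc, ?_,
        hMd.image_upShiftSet hk hMk x⟩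
    · rw [Finset.sum_image (upShiftSet_injOn M k x)] at key
      refine absurd key (not_le.2 (Finset.sum_lt_sum ?_ ⟨A, hA, ?_⟩))
      · intro B _
        unfold upShiftSet
        split_ifs
        · exact Finset.card_le_card (Finset.subset_insert x B)
        · exact le_rfl
      · unfold upShiftSet
        rw [if_pos ⟨hx, hAk, hn⟩, Finset.card_insert_of_notMem hx]
        omega
    · intro B' hB'
      obtain ⟨B, hB, rfl⟩ := Finset.mem_image.1 hB'
      exact card_upShiftSet_le (hMk B hB)
  have aux : ∀ X : Finset α, ∀ A ∈ M, Disjoint A X → (A ∪ X).card ≤ k → A ∪ X ∈ M := by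
    intro X
    induction X using Finset.induction_on with
    | empty => intro A hA _ _; simpa using hA
    | insert x X hx ih =>
      intro A hA hd hc
      rw [Finset.disjoint_insert_right] at hd
      have hxm : x ∉ A ∪ X := by simp [hd.1, hx]
      rw [Finset.union_insert, Finset.card_insert_of_notMem hxm] at hc
      rw [Finset.union_insert]
      exact step _ (ih A hA hd.2 (by omega)) x hxm (by omega)
  intro A hA C hAC hC
  have := aux (C \ A) A hA Finset.disjoint_sdiff
  rw [Finset.union_sdiff_of_subset hAC] at this
  exact this hC

end UpShift
-- Resolving conflicts between complementary levels
-- Multiplying the two failed inequalities contradicts `h`. This lets one of two competing levels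
-- pay for both.
theorem cross_le_or_cross_le {a b p q p' q' : ℕ} (h : p' * q' ≤ p * q) :
    b * q' ≤ a * p ∨ a * p' ≤ b * q := by
  by_contra! hc
  have h1 : (a * p) * (b * q) < (b * q') * (a * p') :=
    Nat.mul_lt_mul'' hc.1 hc.2
  have h2 : (b * q') * (a * p') = (a * b) * (p' * q') := by ring
  have h3 : (a * p) * (b * q) = (a * b) * (p * q) := by ring
  have := Nat.mul_le_mul_left (a * b) h
  omega

/-- Averaging over the points of `range l`: some point is avoided by many sets. -/
theorem exists_avoided_point {l i : ℕ} {D : Finset (Finset ℕ)} (hl : 0 < l)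
    (hD : ∀ E ∈ D, E ⊆ Finset.range l ∧ E.card = i) :
    ∃ x ∈ Finset.range l, D.card * (l - i) ≤ (D.filter fun E => x ∉ E).card * l := by
  by_contra! hc
  have h1 : ∑ x ∈ Finset.range l, (D.filter fun E => x ∉ E).card = D.card * (l - i) := by
    simp only [Finset.card_filter]
    rw [Finset.sum_comm, Finset.card_eq_sum_ones, Finset.sum_mul]
    refine Finset.sum_congr rfl fun E hE => ?_
    rw [← Finset.card_filter, one_mul]
    have : (Finset.range l).filter (fun x => x ∉ E) = Finset.range l \ E := by
      ext y; simp
    rw [this, Finset.card_sdiff_of_subset (hD E hE).1, (hD E hE).2, Finset.card_range]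
  have h2 := Finset.sum_lt_sum_of_nonempty (Finset.nonempty_range_iff.2 hl.ne') hc
  rw [← Finset.sum_mul, h1, Finset.sum_const, Finset.card_range, smul_eq_mul, mul_comm] at h2
  exact lt_irrefl _ h2

/-- From a graded family `D` select a subfamily without conflicting pairs that keeps the weight;
sets conflict when their sizes add up to `N` and they cover `range l`. -/
theorem exists_conflict_free_subfamily {l N : ℕ} (hl : 0 < l) (u : ℕ → ℕ)
    (hu : ∀ i j, i + j = N → i ≠ j → u (i + 1) * u (j + 1) ≤ u i * u j)
    (hmid : ∀ i, i + i = N → l * u (i + 1) ≤ (l - i) * (u i + u (i + 1)))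
    (D : Finset (Finset ℕ)) (hD : ∀ E ∈ D, E ⊆ Finset.range l) (hDN : ∀ E ∈ D, E.card ≤ N) :
    ∃ S ⊆ D, (∀ A ∈ S, ∀ B ∈ S, A.card + B.card = N → A ∪ B ≠ Finset.range l) ∧
      ∑ E ∈ D, u (E.card + 1) ≤ ∑ E ∈ S, (u E.card + u (E.card + 1)) := by
  classical
  obtain ⟨x, hx, hxD⟩ := exists_avoided_point (i := N / 2) (D := D.filter fun E => E.card = N / 2)
    hl (fun E hE => by
      rw [Finset.mem_filter] at hE
      exact ⟨hD E hE.1, hE.2⟩)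
  let a : ℕ → ℕ := fun i => (D.filter fun E => E.card = i).card
  -- The second branch negates the first at N - i, so exactly one of two distinct complementary
  -- levels is good, even in a tie.
  let good : ℕ → Prop := fun i =>
    if 2 * i < N then a (N - i) * u (N - i + 1) ≤ a i * u i
    else ¬ a i * u (i + 1) ≤ a (N - i) * u (N - i)
  let keep : Finset ℕ → Prop := fun E => if 2 * E.card = N then x ∉ E else good E.card
  have hgood : ∀ i, i ≤ N → 2 * i ≠ N → (good (N - i) ↔ ¬ good i) := by
    intro i hi hne
    have hNi : N - (N - i) = i := by omega
    simp only [good, hNi]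
    by_cases h : 2 * i < N
    · rw [if_neg (by omega), if_pos h]
    · rw [if_pos (by omega), if_neg h, not_not]
  refine ⟨D.filter keep, Finset.filter_subset _ _, ?_, ?_⟩
  · intro A hA B hB hAB hcov
    rw [Finset.mem_filter] at hA hB
    have hA2 := hA.2
    have hB2 := hB.2
    simp only [keep] at hA2 hB2
    by_cases h : 2 * A.card = N
    · rw [if_pos h] at hA2
      rw [if_pos (by omega)] at hB2
      rw [← hcov, Finset.mem_union] at hx
      tauto
    · rw [if_neg h] at hA2
      rw [if_neg (by omega), show B.card = N - A.card by omega,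
        hgood A.card (by omega) h] at hB2
      exact hB2 hA2
  · let f : ℕ → ℕ := fun i => ((D.filter keep).filter fun E => E.card = i).card * (u i + u (i + 1))
    let g : ℕ → ℕ := fun i => a i * u (i + 1)
    have hf : ∑ E ∈ D.filter keep, (u E.card + u (E.card + 1)) = ∑ i ∈ Finset.range (N + 1), f i := by
      rw [← Finset.sum_fiberwise_of_maps_to (s := D.filter keep) (t := Finset.range (N + 1))
        (g := Finset.card) (fun E hE => by
          have := hDN E (Finset.mem_filter.1 hE).1
          rw [Finset.mem_range]; omega)]
      refine Finset.sum_congr rfl fun i _ => ?_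
      rw [Finset.sum_congr rfl (g := fun _ => u i + u (i + 1)) (fun E hE => by
        rw [(Finset.mem_filter.1 hE).2]), Finset.sum_const, smul_eq_mul]
    have hg : ∑ E ∈ D, u (E.card + 1) = ∑ i ∈ Finset.range (N + 1), g i := by
      rw [← Finset.sum_fiberwise_of_maps_to (s := D) (t := Finset.range (N + 1))
        (g := Finset.card) (fun E hE => by
          have := hDN E hE
          rw [Finset.mem_range]; omega)]
      refine Finset.sum_congr rfl fun i _ => ?_
      rw [Finset.sum_congr rfl (g := fun _ => u (i + 1)) (fun E hE => by
        rw [(Finset.mem_filter.1 hE).2]), Finset.sum_const, smul_eq_mul]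
    have fgood : ∀ i, 2 * i ≠ N → good i → f i = a i * (u i + u (i + 1)) := by
      intro i hi h
      simp only [f, a]
      congr 2
      ext E
      simp only [Finset.mem_filter, keep]
      constructor
      · rintro ⟨⟨h1, -⟩, h2⟩; exact ⟨h1, h2⟩
      · rintro ⟨h1, rfl⟩
        exact ⟨⟨h1, by rwa [if_neg hi]⟩, rfl⟩
    have pair : ∀ i, 2 * i < N → g i + g (N - i) ≤ f i + f (N - i) := by
      intro i hi
      have hne : 2 * i ≠ N := by omega
      have hne' : 2 * (N - i) ≠ N := by omega
      have h12 := cross_le_or_cross_le (a := a i) (b := a (N - i))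
        (hu i (N - i) (by omega) (by omega))
      by_cases h : good i
      · have e := fgood i hne h
        simp only [good, if_pos hi] at h
        rw [e, mul_add]
        simp only [g]
        omega
      · have e := fgood (N - i) hne' ((hgood i (by omega) hne).2 h)
        simp only [good, if_pos hi] at h
        have h2 := h12.resolve_left h
        rw [e, mul_add]
        simp only [g]
        omega
    have mid : ∀ i, 2 * i = N → g i ≤ f i := by
      intro i hi
      have hi' : N / 2 = i := by omega
      rw [hi'] at hxD
      have e : ((D.filter keep).filter fun E => E.card = i) =
          (D.filter fun E => E.card = i).filter fun E => x ∉ E := by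
        ext E
        simp only [Finset.mem_filter, keep]
        constructor
        · rintro ⟨⟨h1, h3⟩, h2⟩
          rw [if_pos (by omega)] at h3
          exact ⟨⟨h1, h2⟩, h3⟩
        · rintro ⟨⟨h1, h2⟩, h3⟩
          exact ⟨⟨h1, by rwa [if_pos (by omega)]⟩, h2⟩
      simp only [f, g, e, a]
      set p := (D.filter fun E => E.card = i).card
      set q := ((D.filter fun E => E.card = i).filter fun E => x ∉ E).card
      refine Nat.le_of_mul_le_mul_left ?_ hl
      calc l * (p * u (i + 1)) = p * (l * u (i + 1)) := by ring
        _ ≤ p * ((l - i) * (u i + u (i + 1))) := Nat.mul_le_mul_left _ (hmid i (by omega))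
        _ = (p * (l - i)) * (u i + u (i + 1)) := by ring
        _ ≤ (q * l) * (u i + u (i + 1)) := Nat.mul_le_mul_right _ hxD
        _ = l * (q * (u i + u (i + 1))) := by ring
    -- Pairing i with N - i over the whole range counts every level twice; the factor 2 cancels at
    -- the end.
    have all : ∀ i ∈ Finset.range (N + 1), g i + g (N - i) ≤ f i + f (N - i) := by
      intro i hi
      rw [Finset.mem_range] at hi
      rcases lt_trichotomy (2 * i) N with h | h | h
      · exact pair i h
      · rw [show N - i = i by omega]
        exact add_le_add (mid i h) (mid i h)
      · have := pair (N - i) (by omega)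
        rw [show N - (N - i) = i by omega] at this
        omega
    have hs := Finset.sum_le_sum all
    have rf := Finset.sum_range_reflect f (N + 1)
    have rg := Finset.sum_range_reflect g (N + 1)
    simp only [Nat.add_sub_cancel] at rf rg
    rw [Finset.sum_add_distrib, Finset.sum_add_distrib, rf, rg] at hs
    rw [hf, hg]
    omega

/-! ### Dropping one point -/

/-- Pulling a weighted `t`-intersecting family from `range (l + 1)` down to `range l`. -/
theorem IsTIntersecting.exists_pull {l t : ℕ} (ht : 1 ≤ t) (htl : t ≤ l) (u : ℕ → ℕ)
    (hu : ∀ i j, i + j = l + t - 1 → i ≠ j → u (i + 1) * u (j + 1) ≤ u i * u j)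
    (hmid : ∀ i, i + i = l + t - 1 → l * u (i + 1) ≤ (l - i) * (u i + u (i + 1)))
    {G : Finset (Finset ℕ)} (hG : IsTIntersecting t G)
    (hGs : G ⊆ (Finset.range (l + 1)).powerset) :
    ∃ G' ⊆ (Finset.range l).powerset, IsTIntersecting t G' ∧
      ∑ E ∈ G, u E.card ≤ ∑ E ∈ G', (u E.card + u (E.card + 1)) := by
  classical
  obtain ⟨M, hMs, hMt, hMu, hins, hshift⟩ :=
    hG.exists_stable (a := l) (Finset.self_mem_range_succ l) hGs u
  -- M is the disjoint union of H, H with l adjoined and D with l adjoined. Only D can cost weight.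
  let H := M.filter fun E => l ∉ E
  let C := M.filter fun E => l ∈ E ∧ E.erase l ∉ M
  let D := C.image fun E => E.erase l
  have hlt : ∀ E ∈ M, ∀ y ∈ E, y ≠ l → y < l := by
    intro E hE y hy hne
    have := Finset.mem_range.1 (Finset.mem_powerset.1 (hMs hE) hy)
    omega
  have hDmem : ∀ E, E ∈ D ↔ l ∉ E ∧ E ∉ M ∧ insert l E ∈ M := by
    intro E
    simp only [D, C, Finset.mem_image, Finset.mem_filter]
    constructor
    · rintro ⟨A, ⟨hA, hl, hn⟩, rfl⟩
      exact ⟨Finset.notMem_erase _ _, hn, by rwa [Finset.insert_erase hl]⟩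
    · rintro ⟨h1, h2, h3⟩
      exact ⟨insert l E, ⟨h3, Finset.mem_insert_self _ _, by rwa [Finset.erase_insert h1]⟩,
        Finset.erase_insert h1⟩
  have hDl : ∀ E ∈ D, E ⊆ Finset.range l := by
    intro E hE y hy
    obtain ⟨h1, -, h3⟩ := (hDmem E).1 hE
    exact Finset.mem_range.2 (hlt _ h3 y (Finset.mem_insert_of_mem hy) (fun h => h1 (h ▸ hy)))
  have hHl : ∀ E ∈ H, E ⊆ Finset.range l := by
    intro E hE y hy
    obtain ⟨h1, h2⟩ := Finset.mem_filter.1 hE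
    exact Finset.mem_range.2 (hlt _ h1 y hy (fun h => h2 (h ▸ hy)))
  have hDN : ∀ E ∈ D, E.card ≤ l + t - 1 := by
    intro E hE
    have := Finset.card_le_card (hDl E hE)
    rw [Finset.card_range] at this
    omega
  have hHD : ∀ A ∈ H, ∀ B ∈ D, t ≤ (A ∩ B).card := by
    intro A hA B hB
    obtain ⟨h1, h2⟩ := Finset.mem_filter.1 hA
    obtain ⟨-, -, h3⟩ := (hDmem B).1 hB
    have := hMt A h1 _ h3
    rwa [Finset.inter_insert_of_notMem h2] at this
  have hDD : ∀ A ∈ D, ∀ B ∈ D, (A.card + B.card = l + t - 1 → A ∪ B ≠ Finset.range l) →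
      t ≤ (A ∩ B).card := by
    intro A hA B hB hcov
    obtain ⟨hlA, -, hA3⟩ := (hDmem A).1 hA
    obtain ⟨hlB, -, hB3⟩ := (hDmem B).1 hB
    have hsum := Finset.card_union_add_card_inter A B
    -- A and B share at least t - 1 points, so if they cover `range l` they fail only when |A| + |B|
    -- = l + t - 1.
    by_cases hc : A ∪ B = Finset.range l
    · have h1 := hMt _ hA3 _ hB3
      rw [← Finset.insert_inter_distrib, Finset.card_insert_of_notMem (by simp [hlA])] at h1
      rw [hc, Finset.card_range] at hsum
      have : A.card + B.card ≠ l + t - 1 := fun h => hcov h hc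
      omega
    -- Shifting l to x turns `insert l A` into `insert x A`, which meets `insert l B` exactly in A ∩
    -- B.
    · obtain ⟨x, hx, hxn⟩ : ∃ x ∈ Finset.range l, x ∉ A ∪ B := by
        by_contra! hcon
        exact hc (Finset.Subset.antisymm (Finset.union_subset (hDl A hA) (hDl B hB)) hcon)
      rw [Finset.mem_union, not_or] at hxn
      have hxl := Finset.mem_range.1 hx
      have hA' := hshift _ hA3 (Finset.mem_insert_self _ _) x (by simp; omega)
        (by simp only [Finset.mem_insert, not_or]; exact ⟨hxl.ne, hxn.1⟩)
      rw [Finset.erase_insert hlA] at hA'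
      refine (hMt _ hA' _ hB3).trans (Finset.card_le_card ?_)
      intro y
      simp only [Finset.mem_inter, Finset.mem_insert]
      rintro ⟨rfl | h1, rfl | h2⟩
      · omega
      · exact absurd h2 hxn.2
      · exact absurd h1 hlA
      · exact ⟨h1, h2⟩
  obtain ⟨S, hSD, hSfree, hSu⟩ :=
    exists_conflict_free_subfamily (by omega : 0 < l) u hu hmid D hDl hDN
  have hdisj : Disjoint H S := by
    rw [Finset.disjoint_left]
    intro E hE hES
    exact ((hDmem E).1 (hSD hES)).2.1 (Finset.mem_filter.1 hE).1
  refine ⟨H ∪ S, ?_, ?_, hMu.trans ?_⟩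
  · intro E hE
    rw [Finset.mem_powerset]
    rcases Finset.mem_union.1 hE with h | h
    · exact hHl E h
    · exact hDl E (hSD h)
  · intro A hA B hB
    rcases Finset.mem_union.1 hA with hA | hA <;> rcases Finset.mem_union.1 hB with hB | hB
    · exact hMt A (Finset.mem_filter.1 hA).1 B (Finset.mem_filter.1 hB).1
    · exact hHD A hA B (hSD hB)
    · rw [Finset.inter_comm]
      exact hHD B hB A (hSD hA)
    · exact hDD A (hSD hA) B (hSD hB) (hSfree A hA B hB)
  · rw [Finset.sum_union hdisj]
    have hsplit : ∑ E ∈ M, u E.card = ∑ E ∈ H, (u E.card + u (E.card + 1)) +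
        ∑ E ∈ D, u (E.card + 1) := by
      have hinjH : Set.InjOn (fun E : Finset ℕ => insert l E) (H : Set (Finset ℕ)) := by
        intro A hA B hB h
        have hA' := (Finset.mem_filter.1 hA).2
        have hB' := (Finset.mem_filter.1 hB).2
        rw [← Finset.erase_insert hA', ← Finset.erase_insert hB']
        exact congrArg (fun E => Finset.erase E l) h
      have hinjD : Set.InjOn (fun E : Finset ℕ => insert l E) (D : Set (Finset ℕ)) := by
        intro A hA B hB h
        have hA' := ((hDmem A).1 hA).1
        have hB' := ((hDmem B).1 hB).1
        rw [← Finset.erase_insert hA', ← Finset.erase_insert hB']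
        exact congrArg (fun E => Finset.erase E l) h
      have hM : M = H ∪ (H.image (fun E => insert l E) ∪ D.image (fun E => insert l E)) := by
        ext E
        simp only [Finset.mem_union, Finset.mem_image]
        constructor
        · intro hE
          by_cases hl : l ∈ E
          · right
            by_cases he : E.erase l ∈ M
            · exact Or.inl ⟨E.erase l, Finset.mem_filter.2 ⟨he, Finset.notMem_erase _ _⟩,
                Finset.insert_erase hl⟩
            · exact Or.inr ⟨E.erase l, (hDmem _).2 ⟨Finset.notMem_erase _ _, he,
                by rwa [Finset.insert_erase hl]⟩, Finset.insert_erase hl⟩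
          · exact Or.inl (Finset.mem_filter.2 ⟨hE, hl⟩)
        · rintro (h | ⟨A, hA, rfl⟩ | ⟨A, hA, rfl⟩)
          · exact (Finset.mem_filter.1 h).1
          · exact hins A (Finset.mem_filter.1 hA).1
          · exact ((hDmem A).1 hA).2.2
      have hd1 : Disjoint (H.image (fun E => insert l E)) (D.image (fun E => insert l E)) := by
        rw [Finset.disjoint_left]
        intro E hE hE'
        obtain ⟨A, hA, rfl⟩ := Finset.mem_image.1 hE
        obtain ⟨B, hB, h⟩ := Finset.mem_image.1 hE'
        have hA' := (Finset.mem_filter.1 hA)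
        have hB' := ((hDmem B).1 hB)
        have : B = A := by
          rw [← Finset.erase_insert hA'.2, ← Finset.erase_insert hB'.1]
          exact congrArg (fun E => Finset.erase E l) h
        exact hB'.2.1 (this ▸ hA'.1)
      have hd2 : Disjoint H (H.image (fun E => insert l E) ∪ D.image (fun E => insert l E)) := by
        rw [Finset.disjoint_left]
        intro E hE hE'
        refine (Finset.mem_filter.1 hE).2 ?_
        rcases Finset.mem_union.1 hE' with h | h <;>
        · obtain ⟨A, -, rfl⟩ := Finset.mem_image.1 h
          exact Finset.mem_insert_self _ _
      conv_lhs => rw [hM]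
      rw [Finset.sum_union hd2, Finset.sum_union hd1, Finset.sum_image hinjH,
        Finset.sum_image hinjD, Finset.sum_add_distrib, add_assoc]
      congr 2
      · refine Finset.sum_congr rfl fun E hE => ?_
        rw [Finset.card_insert_of_notMem (Finset.mem_filter.1 hE).2]
      · refine Finset.sum_congr rfl fun E hE => ?_
        rw [Finset.card_insert_of_notMem ((hDmem E).1 hE).1]
    rw [hsplit]
    omega
-- Binomial weights and the uniform bound
theorem choose_mul_choose_le {m p q : ℕ} (h : p + q + 1 ≤ m) :
    m.choose p * m.choose q ≤ m.choose (p + 1) * m.choose (q + 1) := by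
  have hp := Nat.choose_succ_right_eq m p
  have hq := Nat.choose_succ_right_eq m q
  refine Nat.le_of_mul_le_mul_left (c := (p + 1) * (q + 1)) ?_ (by positivity)
  calc (p + 1) * (q + 1) * (m.choose p * m.choose q)
      ≤ ((m - q) * (m - p)) * (m.choose p * m.choose q) :=
        Nat.mul_le_mul_right _ (Nat.mul_le_mul (by omega) (by omega))
    _ = (m.choose p * (m - p)) * (m.choose q * (m - q)) := by ring
    _ = (p + 1) * (q + 1) * (m.choose (p + 1) * m.choose (q + 1)) := by
        rw [← hp, ← hq]; ring

/-- The number of `k`-subsets of an `(l + m)`-set with a prescribed trace of size `i` on the first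
`l` points. -/
def traceWeight (m k i : ℕ) : ℕ := if i ≤ k then m.choose (k - i) else 0

/-- Pascal's rule: the dropped point joins the m free points. -/
theorem traceWeight_succ (m k i : ℕ) :
    traceWeight m k i + traceWeight m k (i + 1) = traceWeight (m + 1) k i := by
  unfold traceWeight
  rcases lt_trichotomy i k with h | rfl | h
  · obtain ⟨p, rfl⟩ := Nat.exists_eq_add_of_lt h
    rw [if_pos (by omega), if_pos (by omega), if_pos (by omega),
      show i + p + 1 - i = p + 1 by omega, show i + p + 1 - (i + 1) = p by omega,
      Nat.choose_succ_succ, add_comm]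
  · simp
  · rw [if_neg (by omega), if_neg (by omega), if_neg (by omega)]

theorem two_mul_lt_of_threshold {n k t : ℕ} (ht : 1 ≤ t) (htk : t ≤ k)
    (hn : (k - t + 1) * (t + 1) ≤ n) : 2 * k + 1 ≤ n + t := by
  obtain ⟨d, rfl⟩ := Nat.exists_eq_add_of_le htk
  obtain ⟨e, rfl⟩ := Nat.exists_eq_add_of_le ht
  rw [Nat.add_sub_cancel_left] at hn
  nlinarith [Nat.zero_le (d * e)]

/-- For p = k-i-1 and q = k-j-1, the condition p + q + 1 ≤ m is exactly 2k + 1 ≤ n + t. -/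
theorem traceWeight_mul_le {n k t l : ℕ} (ht : 1 ≤ t) (htk : t ≤ k)
    (hn : (k - t + 1) * (t + 1) ≤ n) {m : ℕ} (hm : m + (l + 1) = n) {i j : ℕ}
    (hij : i + j = l + t - 1) :
    traceWeight m k (i + 1) * traceWeight m k (j + 1) ≤ traceWeight m k i * traceWeight m k j := by
  have h2 := two_mul_lt_of_threshold ht htk hn
  by_cases hi : i + 1 ≤ k
  · by_cases hj : j + 1 ≤ k
    · unfold traceWeight
      rw [if_pos hi, if_pos hj, if_pos (by omega), if_pos (by omega),
        show k - i = k - (i + 1) + 1 by omega, show k - j = k - (j + 1) + 1 by omega]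
      exact choose_mul_choose_le (by omega)
    · simp [traceWeight, hj]
  · simp [traceWeight, hi]

theorem mul_traceWeight_le {n k t l : ℕ} (ht : 1 ≤ t) (htl : t ≤ l)
    (hn : (k - t + 1) * (t + 1) ≤ n) {m : ℕ} (hm : m + (l + 1) = n) {i : ℕ}
    (hi : i + i = l + t - 1) :
    l * traceWeight m k (i + 1) ≤ (l - i) * (traceWeight m k i + traceWeight m k (i + 1)) := by
  rw [traceWeight_succ]
  by_cases hik : i + 1 ≤ k
  · obtain ⟨p, rfl⟩ := Nat.exists_eq_add_of_le hik
    unfold traceWeight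
    rw [if_pos (by omega), if_pos (by omega), show i + 1 + p - (i + 1) = p by omega,
      show i + 1 + p - i = p + 1 by omega]
    obtain ⟨r, hr⟩ : ∃ r, l = i + (r + 1) := ⟨l - i - 1, by omega⟩
    obtain ⟨e, rfl⟩ := Nat.exists_eq_add_of_le ht
    obtain rfl : i = e + 1 + r := by omega
    rw [show l - (e + 1 + r) = r + 1 by omega]
    rw [show e + 1 + r + 1 + p - (1 + e) + 1 = p + 1 + (r + 1) by omega] at hn
    -- With n at the threshold the sides differ by e·r·(p + r + 2), so the estimate is tight when r
    -- = 0, that is l = t + 1.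
    have key : l * (p + 1) ≤ (r + 1) * (m + 1) := by
      zify at hn hr hm ⊢
      have h1 : (0 : ℤ) ≤ p * (r * e) := by positivity
      have h2 : (0 : ℤ) ≤ r * (r * e) := by positivity
      have h3 : (0 : ℤ) ≤ r * e := by positivity
      have h4 := mul_le_mul_of_nonneg_left hn (by positivity : (0 : ℤ) ≤ (r : ℤ) + 1)
      have h5 : (m : ℤ) = n - (e + 1 + r + (r + 1) + 1) := by
        rw [← hm, hr]; ring
      rw [h5, hr]
      nlinarith
    refine Nat.le_of_mul_le_mul_left (c := p + 1) ?_ (by omega)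
    calc (p + 1) * (l * m.choose p) = (l * (p + 1)) * m.choose p := by ring
      _ ≤ ((r + 1) * (m + 1)) * m.choose p := Nat.mul_le_mul_right _ key
      _ = (r + 1) * ((m + 1) * m.choose p) := by ring
      _ = (p + 1) * ((r + 1) * (m + 1).choose (p + 1)) := by
        rw [Nat.add_one_mul_choose_eq]; ring
  · rw [traceWeight, if_neg hik]
    exact Nat.zero_le _

theorem IsTIntersecting.sum_traceWeight_le {n k t : ℕ} (ht : 1 ≤ t) (htk : t ≤ k)
    (hn : (k - t + 1) * (t + 1) ≤ n) (d : ℕ) : ∀ m, m + (t + d) = n →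
    ∀ G : Finset (Finset ℕ), IsTIntersecting t G → G ⊆ (Finset.range (t + d)).powerset →
      ∑ E ∈ G, traceWeight m k E.card ≤ (n - t).choose (k - t) := by
  induction d with
  | zero =>
    intro m hm G hG hGs
    have hsub : G ⊆ {Finset.range t} := by
      intro E hE
      rw [Finset.mem_singleton]
      have h1 := hG E hE E hE
      rw [Finset.inter_self] at h1
      exact Finset.eq_of_subset_of_card_le (Finset.mem_powerset.1 (hGs hE)) (by simpa using h1)
    refine (Finset.sum_le_sum_of_subset hsub).trans ?_
    rw [Finset.sum_singleton, Finset.card_range, traceWeight, if_pos htk,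
      show n - t = m by omega]
  | succ d ih =>
    intro m hm G hG hGs
    obtain ⟨G', hG's, hG't, hle⟩ := hG.exists_pull ht (Nat.le_add_right t d) (traceWeight m k)
      (fun i j hij _ => traceWeight_mul_le ht htk hn (by omega) hij)
      (fun i hi => mul_traceWeight_le ht (Nat.le_add_right t d) hn (by omega) hi) hGs
    simp only [traceWeight_succ] at hle
    exact hle.trans (ih (m + 1) (by omega) G' hG't hG's)

/-- The Erdős–Ko–Rado theorem for `t`-intersecting uniform families, in the exact range. -/
theorem IsTIntersecting.card_le_choose {n k t : ℕ} (htk : t ≤ k)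
    (hn : (k - t + 1) * (t + 1) ≤ n) {F : Finset (Finset (Fin n))} (hF : IsTIntersecting t F)
    (hk : ∀ A ∈ F, A.card = k) : F.card ≤ (n - t).choose (k - t) := by
  rcases Nat.eq_zero_or_pos t with rfl | ht
  · have : F ⊆ Finset.powersetCard k Finset.univ := fun A hA =>
      Finset.mem_powersetCard.2 ⟨Finset.subset_univ A, hk A hA⟩
    simpa using Finset.card_le_card this
  · have htn : t ≤ n := by
      have := two_mul_lt_of_threshold ht htk hn
      omega
    let G : Finset (Finset ℕ) := F.image fun A => A.map Fin.valEmbedding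
    have hinj : Set.InjOn (fun A : Finset (Fin n) => A.map Fin.valEmbedding) F :=
      fun A _ B _ h => Finset.map_injective _ h
    have hG : IsTIntersecting t G := by
      intro A' hA' B' hB'
      obtain ⟨A, hA, rfl⟩ := Finset.mem_image.1 hA'
      obtain ⟨B, hB, rfl⟩ := Finset.mem_image.1 hB'
      rw [← Finset.map_inter, Finset.card_map]
      exact hF A hA B hB
    have hGs : G ⊆ (Finset.range (t + (n - t))).powerset := by
      intro A' hA'
      obtain ⟨A, hA, rfl⟩ := Finset.mem_image.1 hA'
      rw [Finset.mem_powerset]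
      intro y hy
      obtain ⟨z, -, rfl⟩ := Finset.mem_map.1 hy
      have := z.2
      simp only [Fin.valEmbedding_apply, Finset.mem_range]
      omega
    -- With no free points left a k-set has weight 1, so the total weight is the cardinality.
    have := IsTIntersecting.sum_traceWeight_le ht htk hn (n - t) 0 (by omega) G hG hGs
    rw [Finset.sum_image hinj] at this
    refine le_trans (le_of_eq ?_) this
    rw [Finset.card_eq_sum_ones]
    refine Finset.sum_congr rfl fun A hA => ?_
    rw [Finset.card_map, hk A hA]
    simp [traceWeight]

/-! ### Summing over the layers -/

theorem theorem1p2 (n k t : ℕ)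
    (hn : ((k : ℤ) - (t : ℤ) + 1) * ((t : ℤ) + 1) ≤ (n : ℤ))
    (F : Finset (Finset (Fin n)))
    (hF : ∀ A ∈ F, A.card ≤ k)
    (hsymm : ∀ A ∈ F, ∀ B ∈ F, (A ∩ B).card < t →
      ((symmDiff A B).card : ℤ) ≤ (k : ℤ) - (t : ℤ)) :
    F.card ≤ ∑ i ∈ Finset.range (k + 1 - t), (n - t).choose (k - t - i) := by
  rcases lt_or_ge k t with hkt | htk
  · have hempty : F = ∅ := by
      rw [Finset.eq_empty_iff_forall_notMem]
      intro A hA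
      have h1 := hsymm A hA A hA (by rw [Finset.inter_self]; exact (hF A hA).trans_lt hkt)
      rw [symmDiff_self] at h1
      simp at h1
      omega
    simp [hempty]
  · obtain ⟨d, rfl⟩ := Nat.exists_eq_add_of_le htk
    have hn' : (d + 1) * (t + 1) ≤ n := by
      zify
      push_cast at hn
      linarith
    have hclose : IsCloseOrTIntersecting t d F := by
      intro A hA B hB h
      have := hsymm A hA B hB h
      push_cast at this
      omega
    obtain ⟨G, hGc, hGk, hG⟩ := hclose.exists_isTIntersecting (k := t + d) (add_comm d t)
      (by rw [Fintype.card_fin]; nlinarith [Nat.zero_le (d * t)]) hF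
    have hGt : ∀ A ∈ G, t ≤ A.card := fun A hA => by simpa using hG A hA A hA
    rw [show t + d + 1 - t = d + 1 by omega, show t + d - t = d by omega, ← hGc,
      Finset.card_eq_sum_card_fiberwise (f := fun A => t + d - A.card)
        (t := Finset.range (d + 1)) (fun A hA => by
          have := hGt A hA
          simp only [Finset.coe_range, Set.mem_Iio]
          omega)]
    refine Finset.sum_le_sum fun i hi => ?_
    rw [Finset.mem_range] at hi
    -- Layer i consists of sets of size k - i, for which the threshold on n is only weaker.
    have key := IsTIntersecting.card_le_choose (n := n) (k := t + (d - i)) (t := t)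
      (F := G.filter fun A => t + d - A.card = i) (by omega) ?_ ?_ ?_
    · rwa [show t + (d - i) - t = d - i by omega] at key
    · rw [show t + (d - i) - t = d - i by omega]
      exact (Nat.mul_le_mul_right _ (by omega)).trans hn'
    · intro A hA B hB
      exact hG A (Finset.mem_filter.1 hA).1 B (Finset.mem_filter.1 hB).1
    · intro A hA
      obtain ⟨h1, h2⟩ := Finset.mem_filter.1 hA
      have := hGk A h1
      omega
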